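/- All rings are commutative with $1$. For a ring extension $R\subseteq S$, let $[R,S]$ be the set of $R$-subalgebras of $S$. The extension is called Prüfer if $R\subseteq T$ is a flat epimorphism of commutative rings for every $T\in[R,S]$; quasi-Prüfer if $\overline R\subseteq S$ is Prüfer, where $\overline R$ is the integral closure of $R$ in $S$; and almost-Prüfer if there is $T\in[R,S]$ such that $R\subseteq T$ is Prüfer and $T\subseteq S$ is integral. The Prüfer hull $\widetilde R$ (resp. the Morita hull $\widehat R$) of $R$ in $S$ is the greatest $T\in[R,S]$ such that $R\subseteq T$ is Prüfer (resp. a flat epimorphism). For a prime ideal $P$ of $R$ and an $R$-subalgebra $T$ of $S$, let $T_P=T_{R\setminus P}$, regarded as an $R_P$-subalgebra of $S_P=S_{R\setminus P}$, and let $\widetilde{R_P}$ be the Prüfer hull of $R_P$ in $S_P$. **Theorem.** Let $R\subseteq S$ be an almost-Prüfer extension. Then $R\subseteq S$ is quasi-Prüfer. Moreover, the hulls $\widetilde R$, $\widehat R$ and, for each prime ideal $P$ of $R$, $\widetilde{R_P}$ exist, and $\widetilde R=\widehat R$ and $(\widetilde R)_P=\widetilde{R_P}$ for each prime ideal $P$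 of $R$. Finally, for every $T\in[R,S]$ such that $R\subseteq T$ is a flat epimorphism, $R\subseteq T$ is Prüfer. -/

import Mathlib

/-!
Ring extensions `R ⊆ S` are written as commutative rings with `[Algebra R S]` whose structure map
is injective; the elements of `[R, S]` are the terms of `Subalgebra R S`.
-/

/-- `R → S` is a flat epimorphism of the category of commutative rings. -/
def IsFlatEpi (R S : Type*) [CommRing R] [CommRing S] [Algebra R S] : Prop :=
  Module.Flat R S ∧ Algebra.IsEpi R S

/-- `R ⊆ S` is a Prüfer extension: `R ⊆ T` is a flat epimorphism for each `T ∈ [R, S]`. -/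
def IsPruferExt (R S : Type*) [CommRing R] [CommRing S] [Algebra R S] : Prop :=
  ∀ T : Subalgebra R S, IsFlatEpi R T

/-- `R ⊆ S` is quasi-Prüfer: the integral closure of `R` in `S` is Prüfer in `S`. -/
def IsQuasiPruferExt (R S : Type*) [CommRing R] [CommRing S] [Algebra R S] : Prop :=
  IsPruferExt (integralClosure R S) S

/-- `R ⊆ S` is almost-Prüfer: it factors as `R ⊆ T ⊆ S` with `R ⊆ T` Prüfer and `T ⊆ S`
integral. -/
def IsAlmostPruferExt (R S : Type*) [CommRing R] [CommRing S] [Algebra R S] : Prop :=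
  ∃ T : Subalgebra R S, IsPruferExt R T ∧ Algebra.IsIntegral T S

/-- The set of all Prüfer subextensions of `R ⊆ S`. -/
def pruferSubexts (R S : Type*) [CommRing R] [CommRing S] [Algebra R S] :
    Set (Subalgebra R S) :=
  {T | IsPruferExt R T}

/-- The set of all flat epimorphic subextensions of `R ⊆ S`. -/
def flatEpiSubexts (R S : Type*) [CommRing R] [CommRing S] [Algebra R S] :
    Set (Subalgebra R S) :=
  {T | IsFlatEpi R T}

/-- The Prüfer hull of `R` in `S`, the greatest Prüfer subextension (taken as a supremum). -/
noncomputable def pruferHull (R S : Type*) [CommRing R] [CommRing S] [Algebra R S] :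
    Subalgebra R S :=
  sSup (pruferSubexts R S)

/-- The Morita hull of `R` in `S`, the greatest flat epimorphic subextension (taken as a
supremum). -/
noncomputable def moritaHull (R S : Type*) [CommRing R] [CommRing S] [Algebra R S] :
    Subalgebra R S :=
  sSup (flatEpiSubexts R S)

/-- For `T ∈ [R, S]` and a prime `P` of `R`, the localization `T_P` as an element of
`[R_P, S_P]`: the fractions `t / s` with `t ∈ T` and `s ∈ R \ P`. Here `R_P` and `S_P` are any
models of the localizations of `R` and `S` at `R \ P`. -/
def localizedSubalgebra {R S : Type*} [CommRing R] [CommRing S] [Algebra R S]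
    (P : Ideal R) [P.IsPrime] (R_P S_P : Type*) [CommRing R_P] [CommRing S_P]
    [Algebra R R_P] [IsLocalization.AtPrime R_P P]
    [Algebra S S_P] [IsLocalization (Algebra.algebraMapSubmonoid S P.primeCompl) S_P]
    [Algebra R S_P] [IsScalarTower R S S_P] [Algebra R_P S_P] [IsScalarTower R R_P S_P]
    (T : Subalgebra R S) : Subalgebra R_P S_P where
  carrier := {x | ∃ t ∈ T, ∃ s ∈ P.primeCompl, algebraMap R S_P s * x = algebraMap S S_P t}
  mul_mem' := by
    rintro x y ⟨t, ht, s, hs, h⟩ ⟨t', ht', s', hs', h'⟩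
    refine ⟨t * t', T.mul_mem ht ht', s * s', mul_mem hs hs', ?_⟩
    rw [map_mul, map_mul, ← h, ← h']
    ring
  add_mem' := by
    rintro x y ⟨t, ht, s, hs, h⟩ ⟨t', ht', s', hs', h'⟩
    refine ⟨algebraMap R S s' * t + algebraMap R S s * t',
      T.add_mem (T.mul_mem (T.algebraMap_mem s') ht) (T.mul_mem (T.algebraMap_mem s) ht'),
      s * s', mul_mem hs hs', ?_⟩
    rw [map_mul, map_add, map_mul, map_mul, ← h, ← h', ← IsScalarTower.algebraMap_apply,
      ← IsScalarTower.algebraMap_apply]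
    ring
  algebraMap_mem' := by
    intro a
    obtain ⟨⟨r, s⟩, h⟩ := IsLocalization.surj P.primeCompl a
    refine ⟨algebraMap R S r, T.algebraMap_mem r, s, s.2, ?_⟩
    rw [IsScalarTower.algebraMap_apply R R_P S_P, ← map_mul, mul_comm, h,
      ← IsScalarTower.algebraMap_apply, ← IsScalarTower.algebraMap_apply]

/-! ### Denominator ideals and coefficients of algebraic relations -/

section Denominators

open Polynomial TensorProduct

variable {R S : Type*} [CommRing R] [CommRing S] [Algebra R S]

/-! Everything is read off from the denominators `(R : x)`. An extension is a flat epimorphism iff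
`(R : x)S = S` for all `x`, and Prüfer iff `(R : x) + x(R : x) = R` for all `x`; the latter unfolds
to equations (`IsElementwisePrufer`) that pass to subalgebras and localizations.

Let `R ⊆ T` be Prüfer and `T ⊆ S` integral. If `x` lies in a flat epimorphic `U`, then `(T : x)S =
S`, and integrality forces `(T : x) = T`, so `x ∈ T` (`IsFlatEpi.le_of_isIntegral`). Hence `T` is
both hulls, every such `U` is Prüfer as a subextension of `T`, and `T_P` plays the role of `T` over
`R_P`.

For quasi-Prüfer, a monic equation over `T` is scaled to have coefficients in `R`, one of them
outside a given prime; `coeff_mem_denominatorNumeratorIdeal` then shows that no maximal ideal of the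
integral closure contains the ideal to be proved trivial. -/

/-- The ideal `(R : x)` of all `a : R` such that `a • x` lies in the image of `R`. -/
def denominatorIdeal (R : Type*) {S : Type*} [CommRing R] [CommRing S] [Algebra R S] (x : S) :
    Ideal R :=
  (LinearMap.range (Algebra.linearMap R S)).comap (LinearMap.toSpanSingleton R S x)

theorem mem_denominatorIdeal {x : S} {a : R} :
    a ∈ denominatorIdeal R x ↔ ∃ c : R, algebraMap R S c = algebraMap R S a * x := by
  simp [denominatorIdeal, Algebra.smul_def]

theorem eq_top_of_mem_denominatorIdeal {x : S} (h : denominatorIdeal R x = ⊤) :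
    ∃ c : R, algebraMap R S c = x := by
  obtain ⟨c, hc⟩ := mem_denominatorIdeal.mp ((Ideal.eq_top_iff_one _).mp h)
  exact ⟨c, by simpa using hc⟩

/-- The ideal `(R : x) + x (R : x)` of `R`. -/
def denominatorNumeratorIdeal (R : Type*) {S : Type*} [CommRing R] [CommRing S] [Algebra R S]
    (x : S) : Ideal R :=
  denominatorIdeal R x ⊔
    Submodule.comap (Algebra.linearMap R S)
      (Submodule.map (LinearMap.toSpanSingleton R S x) (denominatorIdeal R x))

theorem denominatorIdeal_le (x : S) : denominatorIdeal R x ≤ denominatorNumeratorIdeal R x :=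
  le_sup_left

theorem mem_denominatorNumeratorIdeal_of_eq_mul {x : S} {a c : R}
    (h : algebraMap R S c = algebraMap R S a * x) : c ∈ denominatorNumeratorIdeal R x := by
  refine Ideal.mem_sup_right (Submodule.mem_comap.mpr ?_)
  exact ⟨a, mem_denominatorIdeal.mpr ⟨c, h⟩, by simp [Algebra.smul_def, h]⟩

/-- Over an integrally closed base, the coefficients of an algebraic relation of `x` lie in
`(R : x) + x (R : x)`. -/
theorem coeff_mem_denominatorNumeratorIdeal [IsIntegrallyClosedIn R S] {x : S} (n : ℕ) :
    ∀ p : R[X], p.natDegree ≤ n → aeval x p = 0 →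
      ∀ i, p.coeff i ∈ denominatorNumeratorIdeal R x := by
  have hcl : IsIntegrallyClosedIn R S := inferInstance
  obtain ⟨hinj, hint⟩ := isIntegrallyClosedIn_iff.mp hcl
  clear hcl
  induction n with
  | zero =>
    intro p hp h i
    rw [eq_C_of_natDegree_le_zero hp, aeval_C, map_eq_zero_iff _ hinj] at h
    rw [eq_C_of_natDegree_le_zero hp, h]
    simp
  | succ n ih =>
    intro p hp h i
    set a := p.coeff (n + 1) with ha
    have hax : IsIntegral R (algebraMap R S a * x) := by
      rcases hp.eq_or_lt with hd | hd
      · have := isIntegral_leadingCoeff_smul p x h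
        rwa [leadingCoeff, hd, Algebra.smul_def] at this
      · rw [ha, coeff_eq_zero_of_natDegree_lt hd]
        simpa using isIntegral_zero
    obtain ⟨c, hc⟩ := hint hax
    have haJ : a ∈ denominatorNumeratorIdeal R x :=
      denominatorIdeal_le x (mem_denominatorIdeal.mpr ⟨c, hc⟩)
    have hcJ : c ∈ denominatorNumeratorIdeal R x := mem_denominatorNumeratorIdeal_of_eq_mul hc
    -- Since `a * x = c` comes from `R`, the top term `a * x ^ (n + 1)` can be traded for `c * x ^
    -- n`, which lowers the degree.
    set q := p - C a * X ^ (n + 1) + C c * X ^ n with hq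
    have hq0 : aeval x q = 0 := by
      simp only [hq, map_add, map_sub, map_mul, map_pow, aeval_C, aeval_X, h, hc]
      ring
    have hqd : q.natDegree ≤ n := by
      rw [natDegree_le_iff_coeff_eq_zero]
      intro N hN
      rcases (Nat.succ_le_of_lt hN).eq_or_lt with rfl | hN'
      · simp [hq, coeff_X_pow, ha]
      · have : p.coeff N = 0 := coeff_eq_zero_of_natDegree_lt (by omega)
        simp only [hq, coeff_add, coeff_sub, coeff_C_mul, coeff_X_pow, this]
        rw [if_neg (by omega), if_neg (by omega)]
        simp
    have hqi := ih q hqd hq0 i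
    have hpi : p.coeff i = q.coeff i + (a * (X ^ (n + 1) : R[X]).coeff i
        - c * (X ^ n : R[X]).coeff i) := by
      simp only [hq, coeff_add, coeff_sub, coeff_C_mul]
      ring
    rw [hpi]
    exact add_mem hqi (sub_mem (Ideal.mul_mem_right _ _ haJ) (Ideal.mul_mem_right _ _ hcJ))

theorem exists_sum_mul_eq_one_of_map_eq_top {I : Ideal R} (h : I.map (algebraMap R S) = ⊤) :
    ∃ (n : ℕ) (s : Fin n → S) (a : Fin n → R),
      (∀ j, a j ∈ I) ∧ ∑ j, s j * algebraMap R S (a j) = 1 := by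
  have h1 : (1 : S) ∈ Submodule.span S (algebraMap R S '' I) := by
    change (1 : S) ∈ I.map (algebraMap R S)
    simp [h]
  obtain ⟨n, s, g, hg⟩ := Submodule.mem_span_set'.mp h1
  choose a ha hag using fun j => (g j).2
  exact ⟨n, s, a, ha, by simpa [hag] using hg⟩

end Denominators

/-! ### Flat epimorphisms via denominators -/

section FlatEpi

open Polynomial TensorProduct

variable {R S : Type*} [CommRing R] [CommRing S] [Algebra R S]

/-- Multiplication by `x` embeds `R/(R : x)` into `S/R`, and flatness keeps this injective after
tensoring with `S`. The class of `1` goes to `1 ⊗ x = x ⊗ 1`, which dies in `S ⊗ S/R`; so `S/(R :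
x)S = 0`. -/
theorem IsFlatEpi.map_denominatorIdeal_eq_top (h : IsFlatEpi R S) (x : S) :
    (denominatorIdeal R x).map (algebraMap R S) = ⊤ := by
  obtain ⟨hflat, hepi⟩ := h
  set N := LinearMap.range (Algebra.linearMap R S)
  let f : (R ⧸ denominatorIdeal R x) →ₗ[R] S ⧸ N :=
    (denominatorIdeal R x).mapQ N (LinearMap.toSpanSingleton R S x) le_rfl
  have hf : Function.Injective f := by
    rw [injective_iff_map_eq_zero]
    intro z hz
    obtain ⟨r, rfl⟩ := Submodule.mkQ_surjective _ z
    have hz' : N.mkQ (LinearMap.toSpanSingleton R S x r) = 0 := hz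
    rw [Submodule.mkQ_apply, Submodule.Quotient.mk_eq_zero] at hz'
    exact (Submodule.Quotient.mk_eq_zero _).mpr hz'
  have hinj := Module.Flat.lTensor_preserves_injective_linearMap (M := S) f hf
  have h0 : (1 : S) ⊗ₜ[R] (1 : R ⧸ denominatorIdeal R x) = 0 := by
    apply hinj
    have hN : N.mkQ 1 = 0 := (Submodule.Quotient.mk_eq_zero N).mpr ⟨1, by simp⟩
    have hf1 : f 1 = N.mkQ x := by
      change N.mkQ (LinearMap.toSpanSingleton R S x 1) = _
      rw [LinearMap.toSpanSingleton_apply, one_smul]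
    have := congrArg (N.mkQ.lTensor S) ((Algebra.isEpi_iff_forall_one_tmul_eq R S).mp hepi x)
    rw [LinearMap.lTensor_tmul, LinearMap.lTensor_tmul, hN, TensorProduct.tmul_zero] at this
    rw [LinearMap.lTensor_tmul, hf1, this, map_zero]
  have h1 := congrArg (TensorProduct.tensorQuotEquivQuotSMul S (denominatorIdeal R x)) h0
  rw [map_zero] at h1
  erw [TensorProduct.tensorQuotEquivQuotSMul_tmul_mk] at h1
  rw [one_smul, Submodule.Quotient.mk_eq_zero] at h1
  rw [Ideal.eq_top_iff_one]
  rwa [Ideal.smul_top_eq_map] at h1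

theorem IsFlatEpi.of_map_denominatorIdeal_eq_top (hinj : Function.Injective (algebraMap R S))
    (h : ∀ x : S, (denominatorIdeal R x).map (algebraMap R S) = ⊤) : IsFlatEpi R S := by
  constructor
  · refine Module.Flat.of_forall_isTrivialRelation fun {l f x} hfx => ?_
    -- The product ideal supplies denominators `a j` common to all `x k`, so `x k = ∑ (a j * x k) •
    -- s j` has coefficients in `R`, which trivialize the relation.
    have htop : (∏ k, denominatorIdeal R (x k)).map (algebraMap R S) = ⊤ := by
      have : Ideal.mapHom (algebraMap R S) (∏ k, denominatorIdeal R (x k)) = 1 := by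
        rw [map_prod]
        exact Finset.prod_eq_one fun k _ => (h (x k)).trans Ideal.one_eq_top.symm
      exact this.trans Ideal.one_eq_top
    obtain ⟨n, s, a, ha, hs⟩ := exists_sum_mul_eq_one_of_map_eq_top htop
    have hak : ∀ k j, ∃ c : R, algebraMap R S c = algebraMap R S (a j) * x k := fun k j =>
      mem_denominatorIdeal.mp <|
        (Ideal.prod_le_inf.trans (Finset.inf_le (Finset.mem_univ k))) (ha j)
    choose c hc using hak
    refine ⟨n, c, s, fun k => ?_, fun j => hinj ?_⟩
    · calc x k = (∑ j, s j * algebraMap R S (a j)) * x k := by rw [hs, one_mul]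
        _ = ∑ j, c k j • s j := by
          rw [Finset.sum_mul]
          refine Finset.sum_congr rfl fun j _ => ?_
          rw [Algebra.smul_def, hc]
          ring
    · rw [map_zero, map_sum]
      calc ∑ k, algebraMap R S (f k * c k j) = algebraMap R S (a j) * ∑ k, f k • x k := by
            rw [Finset.mul_sum]
            refine Finset.sum_congr rfl fun k _ => ?_
            rw [Algebra.smul_def, map_mul, hc]
            ring
        _ = 0 := by rw [hfx, mul_zero]
  · refine (Algebra.isEpi_iff_forall_one_tmul_eq R S).mpr fun x => ?_
    obtain ⟨n, s, a, ha, hs⟩ := exists_sum_mul_eq_one_of_map_eq_top (h x)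
    choose c hc using fun j => mem_denominatorIdeal.mp (ha j)
    have hx : x = ∑ j, c j • s j := by
      calc x = (∑ j, s j * algebraMap R S (a j)) * x := by rw [hs, one_mul]
        _ = ∑ j, c j • s j := by
          rw [Finset.sum_mul]
          refine Finset.sum_congr rfl fun j _ => ?_
          rw [Algebra.smul_def, hc]
          ring
    have h1 : (1 : S) = ∑ j, a j • s j := by
      rw [← hs]
      exact Finset.sum_congr rfl fun j _ => by rw [Algebra.smul_def, mul_comm]
    calc (1 : S) ⊗ₜ[R] x = ∑ j, (c j • (1 : S)) ⊗ₜ[R] s j := by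
          conv_lhs => rw [hx]
          rw [TensorProduct.tmul_sum]
          simp only [TensorProduct.smul_tmul]
      _ = ∑ j, (a j • x) ⊗ₜ[R] s j := by
          refine Finset.sum_congr rfl fun j _ => ?_
          rw [Algebra.smul_def, Algebra.smul_def, hc, mul_one]
      _ = x ⊗ₜ[R] 1 := by
          conv_rhs => rw [h1]
          rw [TensorProduct.tmul_sum]
          simp only [TensorProduct.smul_tmul]

end FlatEpi

/-! ### The elementwise form of the Prüfer condition -/

section Elementwise

open Polynomial TensorProduct

/-- The elementwise form of the Prüfer condition: for each `x : S` there is `b : R` such that both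
`b * x` and `x - b * x ^ 2` come from `R`. -/
def IsElementwisePrufer (R S : Type*) [CommRing R] [CommRing S] [Algebra R S] : Prop :=
  ∀ x : S, ∃ b c d : R, algebraMap R S c = algebraMap R S b * x ∧
    algebraMap R S d = (1 - algebraMap R S c) * x

variable {R S : Type*} [CommRing R] [CommRing S] [Algebra R S]

theorem IsElementwisePrufer.map_denominatorIdeal_eq_top (h : IsElementwisePrufer R S) (x : S) :
    (denominatorIdeal R x).map (algebraMap R S) = ⊤ := by
  obtain ⟨b, c, d, hc, hd⟩ := h x
  have hb : b ∈ denominatorIdeal R x := mem_denominatorIdeal.mpr ⟨c, hc⟩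
  have hc' : 1 - c ∈ denominatorIdeal R x := mem_denominatorIdeal.mpr ⟨d, by simpa using hd⟩
  rw [Ideal.eq_top_iff_one]
  have : (1 : S) = algebraMap R S (1 - c) + x * algebraMap R S b := by
    rw [map_sub, map_one, hc]
    ring
  rw [this]
  exact add_mem (Ideal.mem_map_of_mem _ hc') (Ideal.mul_mem_left _ _ (Ideal.mem_map_of_mem _ hb))

theorem IsElementwisePrufer.isFlatEpi (hinj : Function.Injective (algebraMap R S))
    (h : IsElementwisePrufer R S) : IsFlatEpi R S :=
  .of_map_denominatorIdeal_eq_top hinj h.map_denominatorIdeal_eq_top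

theorem IsElementwisePrufer.of_injective {T : Type*} [CommRing T] [Algebra R T] (f : T →ₐ[R] S)
    (hf : Function.Injective f) (h : IsElementwisePrufer R S) : IsElementwisePrufer R T := by
  intro x
  obtain ⟨b, c, d, hc, hd⟩ := h (f x)
  exact ⟨b, c, d, hf (by simpa using hc), hf (by simpa using hd)⟩

theorem injective_algebraMap_subalgebra (hinj : Function.Injective (algebraMap R S))
    (T : Subalgebra R S) : Function.Injective (algebraMap R T) :=
  fun _ _ h => hinj (congrArg Subtype.val h)

theorem IsElementwisePrufer.isPruferExt (hinj : Function.Injective (algebraMap R S))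
    (h : IsElementwisePrufer R S) : IsPruferExt R S := fun T =>
  (h.of_injective T.val Subtype.val_injective).isFlatEpi (injective_algebraMap_subalgebra hinj T)

theorem isElementwisePrufer_of_denominatorNumeratorIdeal_eq_top
    (h : ∀ x : S, denominatorNumeratorIdeal R x = ⊤) : IsElementwisePrufer R S := by
  intro x
  have h1 : (1 : R) ∈ denominatorNumeratorIdeal R x := by simp [h]
  obtain ⟨e, he, c, ⟨b, -, hbc⟩, hec⟩ := Submodule.mem_sup.mp h1
  obtain ⟨d, hd⟩ := mem_denominatorIdeal.mp he
  refine ⟨b, c, d, ?_, ?_⟩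
  · rw [← Algebra.smul_def]
    exact hbc.symm
  · rw [hd, eq_sub_of_add_eq hec, map_sub, map_one]

/-- If `S` is integral over `R`, then only elements of `R` have denominators generating the unit
ideal of `S`. -/
theorem denominatorIdeal_eq_top_of_isIntegral [Algebra.IsIntegral R S]
    (hinj : Function.Injective (algebraMap R S)) {x : S}
    (h : (denominatorIdeal R x).map (algebraMap R S) = ⊤) : denominatorIdeal R x = ⊤ := by
  rwa [Ideal.map_eq_top_iff _ hinj (algebraMap_isIntegral_iff.mpr inferInstance)] at h

/-- The integral closure is at once integral and flat epimorphic over `R`, which forces it to equal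
`R`. -/
theorem IsPruferExt.isIntegrallyClosedIn (hinj : Function.Injective (algebraMap R S))
    (h : IsPruferExt R S) : IsIntegrallyClosedIn R S := by
  refine isIntegrallyClosedIn_iff.mpr ⟨hinj, fun {x} hx => ?_⟩
  have hx' : x ∈ integralClosure R S := hx
  have htop := denominatorIdeal_eq_top_of_isIntegral
    (injective_algebraMap_subalgebra hinj (integralClosure R S))
    ((h (integralClosure R S)).map_denominatorIdeal_eq_top ⟨x, hx'⟩)
  obtain ⟨c, hc⟩ := eq_top_of_mem_denominatorIdeal htop
  exact ⟨c, congrArg Subtype.val hc⟩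

/-- Flat epimorphy of `R ⊆ R[x]` gives `p(x) = 1` with coefficients in `(R : x)`. The coefficient
lemma applied to `1 - p` puts `1 - p₀` in the ideal, and `p₀` is already there. -/
theorem IsPruferExt.isElementwisePrufer (hinj : Function.Injective (algebraMap R S))
    (h : IsPruferExt R S) : IsElementwisePrufer R S := by
  have := h.isIntegrallyClosedIn hinj
  refine isElementwisePrufer_of_denominatorNumeratorIdeal_eq_top fun x => ?_
  set I := denominatorIdeal R x
  have hIJ : I ≤ denominatorNumeratorIdeal R x := denominatorIdeal_le x
  -- a relation `p(x) = 1` with coefficients in `(R : x)`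
  obtain ⟨p, hp, hpx⟩ : ∃ p : R[X], (∀ i, p.coeff i ∈ I) ∧ aeval x p = 1 := by
    set T := Algebra.adjoin R {x}
    let y : T := ⟨x, Algebra.subset_adjoin rfl⟩
    obtain ⟨n, s, a, ha, hs⟩ :=
      exists_sum_mul_eq_one_of_map_eq_top ((h T).map_denominatorIdeal_eq_top y)
    have hq : ∀ j, ∃ q : R[X], aeval x q = (s j : S) := fun j => by
      have : (s j : S) ∈ Algebra.adjoin R {x} := (s j).2
      rwa [Algebra.adjoin_singleton_eq_range_aeval] at this
    choose q hq using hq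
    refine ⟨∑ j, q j * C (a j), fun i => ?_, ?_⟩
    · simp only [finsetSum_coeff, coeff_mul_C]
      refine sum_mem fun j _ => Ideal.mul_mem_left _ _ ?_
      obtain ⟨c, hc⟩ := mem_denominatorIdeal.mp (ha j)
      exact mem_denominatorIdeal.mpr ⟨c, congrArg Subtype.val hc⟩
    · simp only [map_sum, map_mul, aeval_C, hq]
      simpa using congrArg (Subtype.val : T → S) hs
  have h0 := coeff_mem_denominatorNumeratorIdeal (x := x) _ (1 - p) le_rfl (by simp [hpx]) 0
  rw [Ideal.eq_top_iff_one]
  have : (1 : R) = (1 - p).coeff 0 + p.coeff 0 := by simp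
  rw [this]
  exact add_mem h0 (hIJ (hp 0))

/-- In a Prüfer extension, finitely many elements can be scaled into the base ring in such a way
that one of them avoids a given prime ideal. -/
theorem IsElementwisePrufer.exists_smul_notMem (h : IsElementwisePrufer R S)
    (P : Ideal R) [P.IsPrime] (s : Finset S) (h1 : 1 ∈ s) :
    ∃ n : S, (∀ t ∈ s, ∃ r : R, algebraMap R S r = n * t) ∧
      ∃ t ∈ s, ∃ r ∉ P, algebraMap R S r = n * t := by
  classical
  suffices ∀ u : Finset S, ∃ n : S, (∀ t ∈ insert 1 u, ∃ r : R, algebraMap R S r = n * t) ∧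
      ∃ t ∈ insert 1 u, ∃ r ∉ P, algebraMap R S r = n * t by
    simpa [h1] using this s
  intro u
  induction u using Finset.induction_on with
  | empty =>
    exact ⟨1, fun t ht => ⟨1, by simp_all⟩, 1, by simp, 1,
      (Ideal.ne_top_iff_one P).mp Ideal.IsPrime.ne_top', by simp⟩
  | insert x u _ ih =>
    obtain ⟨n, hn, t, ht, r, hrP, hr⟩ := ih
    obtain ⟨b, c, d, hc, hd⟩ := h (n * x)
    rw [Finset.insert_comm]
    -- One of `c` and `1 - c` avoids `P`. Scaling by `1 - c` preserves the old witness `t`; scaling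
    -- by `b` makes `x` the new one.
    by_cases hcP : c ∈ P
    · have h1c : 1 - c ∉ P := fun h' =>
        (Ideal.ne_top_iff_one P).mp Ideal.IsPrime.ne_top' (by simpa using add_mem h' hcP)
      refine ⟨algebraMap R S (1 - c) * n, fun y hy => ?_, t, Finset.mem_insert_of_mem ht,
        (1 - c) * r, fun h' => (Ideal.IsPrime.mem_or_mem ‹_› h').elim h1c hrP, by
          rw [map_mul, hr, mul_assoc]⟩
      rcases Finset.mem_insert.mp hy with rfl | hy
      · exact ⟨d, by rw [hd, map_sub, map_one, mul_assoc]⟩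
      · obtain ⟨e, he⟩ := hn y hy
        exact ⟨(1 - c) * e, by rw [map_mul, he, mul_assoc]⟩
    · refine ⟨algebraMap R S b * n, fun y hy => ?_, x, Finset.mem_insert_self _ _, c, hcP, by
        rw [hc, mul_assoc]⟩
      rcases Finset.mem_insert.mp hy with rfl | hy
      · exact ⟨c, by rw [hc, mul_assoc]⟩
      · obtain ⟨e, he⟩ := hn y hy
        exact ⟨b * e, by rw [map_mul, he, mul_assoc]⟩

end Elementwise

/-! ### Quasi-Prüfer property and hulls -/

section AlmostPrufer

open Polynomial TensorProduct

variable {R S : Type*} [CommRing R] [CommRing S] [Algebra R S]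

theorem IsElementwisePrufer.isElementwisePrufer_integralClosure {T : Subalgebra R S}
    (h : IsElementwisePrufer R T) [Algebra.IsIntegral T S] :
    IsElementwisePrufer (integralClosure R S) S := by
  refine isElementwisePrufer_of_denominatorNumeratorIdeal_eq_top fun y => ?_
  by_contra hne
  obtain ⟨Q, hQ, hJQ⟩ := Ideal.exists_le_maximal _ hne
  set P := Q.comap (algebraMap R (integralClosure R S))
  have : P.IsPrime := Ideal.comap_isPrime _ _
  obtain ⟨f, hf, hfy⟩ := Algebra.IsIntegral.isIntegral (R := T) y
  classical
  -- `f` is monic, so `1` is among its coefficients, as the scaling lemma requires.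
  obtain ⟨n, hn, t, ht, r, hrP, hr⟩ := h.exists_smul_notMem P
    ((Finset.range (f.natDegree + 1)).image f.coeff)
    (Finset.mem_image.mpr ⟨f.natDegree, by simp, hf⟩)
  have hn' : ∀ i, ∃ r : R, algebraMap R T r = n * f.coeff i := fun i => by
    by_cases hi : i ≤ f.natDegree
    · exact hn _ (Finset.mem_image_of_mem _ (by simpa [Nat.lt_succ_iff] using hi))
    · exact ⟨0, by rw [coeff_eq_zero_of_natDegree_lt (not_le.mp hi)]; simp⟩
  choose a ha using hn'
  obtain ⟨j, hj, rfl⟩ := Finset.mem_image.mp ht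
  set g : (integralClosure R S)[X] :=
    ∑ i ∈ Finset.range (f.natDegree + 1), C (algebraMap R (integralClosure R S) (a i)) * X ^ i
    with hg
  have hgy : aeval y g = 0 := by
    have hfy' : ∑ i ∈ Finset.range (f.natDegree + 1), (f.coeff i : S) * y ^ i = 0 := by
      rw [eval₂_eq_sum_range] at hfy
      exact hfy
    calc aeval y g = (n : S) * ∑ i ∈ Finset.range (f.natDegree + 1), (f.coeff i : S) * y ^ i := by
          rw [hg, map_sum, Finset.mul_sum]
          refine Finset.sum_congr rfl fun i _ => ?_
          have := congrArg (Subtype.val : T → S) (ha i)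
          change algebraMap R S (a i) = n * (f.coeff i : S) at this
          rw [map_mul, map_pow, aeval_C, aeval_X, ← IsScalarTower.algebraMap_apply, this, mul_assoc]
      _ = 0 := by rw [hfy', mul_zero]
  have hgj : g.coeff j = algebraMap R (integralClosure R S) (a j) := by
    simp only [hg, finsetSum_coeff, coeff_C_mul, coeff_X_pow]
    simp [Finset.mem_range.mp hj]
  have hra : algebraMap R (integralClosure R S) r = g.coeff j := by
    rw [hgj]
    exact Subtype.ext (congrArg (Subtype.val : T → S) (hr.trans (ha j).symm))
  refine hrP (Ideal.mem_comap.mpr ?_)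
  rw [hra]
  exact hJQ (coeff_mem_denominatorNumeratorIdeal _ g le_rfl hgy j)

theorem IsAlmostPruferExt.isQuasiPruferExt (hinj : Function.Injective (algebraMap R S))
    (h : IsAlmostPruferExt R S) : IsQuasiPruferExt R S := by
  obtain ⟨T, hT, _⟩ := h
  have hT' := hT.isElementwisePrufer (injective_algebraMap_subalgebra hinj T)
  exact hT'.isElementwisePrufer_integralClosure.isPruferExt Subtype.val_injective

theorem IsPruferExt.isFlatEpi (hinj : Function.Injective (algebraMap R S))
    (h : IsPruferExt R S) : IsFlatEpi R S :=
  (h.isElementwisePrufer hinj).isFlatEpi hinj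

/-- A subextension over which `S` is integral contains all flat epimorphic subextensions. -/
theorem IsFlatEpi.le_of_isIntegral {T U : Subalgebra R S} [Algebra.IsIntegral T S]
    (hU : IsFlatEpi R U) : U ≤ T := by
  intro x hx
  -- Denominators over `R` remain denominators over `T`, so the unit ideal they generate in `U`
  -- yields `(T : x)S = S`.
  have hle : (denominatorIdeal R (⟨x, hx⟩ : U)).map (algebraMap R T) ≤ denominatorIdeal T x := by
    refine Ideal.map_le_iff_le_comap.mpr fun a ha => ?_
    obtain ⟨c, hc⟩ := mem_denominatorIdeal.mp ha
    exact mem_denominatorIdeal.mpr ⟨algebraMap R T c, congrArg Subtype.val hc⟩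
  have htop : (denominatorIdeal T x).map (algebraMap T S) = ⊤ := by
    rw [eq_top_iff]
    refine le_trans (le_of_eq ?_) (Ideal.map_mono hle)
    have := congrArg (Ideal.map U.val.toRingHom)
      (hU.map_denominatorIdeal_eq_top (⟨x, hx⟩ : U))
    rw [Ideal.map_map, Ideal.map_top] at this
    rw [Ideal.map_map]
    exact this.symm
  obtain ⟨c, rfl⟩ := eq_top_of_mem_denominatorIdeal
    (denominatorIdeal_eq_top_of_isIntegral Subtype.val_injective htop)
  exact c.2

theorem IsElementwisePrufer.of_le {T U : Subalgebra R S} (h : IsElementwisePrufer R T)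
    (hUT : U ≤ T) : IsElementwisePrufer R U :=
  h.of_injective (Subalgebra.inclusion hUT) (Subalgebra.inclusion_injective hUT)

theorem IsPruferExt.isGreatest_pruferSubexts (hinj : Function.Injective (algebraMap R S))
    {T : Subalgebra R S} (h : IsPruferExt R T) [Algebra.IsIntegral T S] :
    IsGreatest (pruferSubexts R S) T :=
  ⟨h, fun U hU => IsFlatEpi.le_of_isIntegral
    (IsPruferExt.isFlatEpi (injective_algebraMap_subalgebra hinj U) hU)⟩

theorem IsPruferExt.isGreatest_flatEpiSubexts (hinj : Function.Injective (algebraMap R S))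
    {T : Subalgebra R S} (h : IsPruferExt R T) [Algebra.IsIntegral T S] :
    IsGreatest (flatEpiSubexts R S) T :=
  ⟨h.isFlatEpi (injective_algebraMap_subalgebra hinj T), fun _ hU => hU.le_of_isIntegral⟩

theorem IsPruferExt.pruferHull_eq (hinj : Function.Injective (algebraMap R S))
    {T : Subalgebra R S} (h : IsPruferExt R T) [Algebra.IsIntegral T S] : pruferHull R S = T :=
  (h.isGreatest_pruferSubexts hinj).isLUB.sSup_eq

theorem IsPruferExt.moritaHull_eq (hinj : Function.Injective (algebraMap R S))
    {T : Subalgebra R S} (h : IsPruferExt R T) [Algebra.IsIntegral T S] : moritaHull R S = T :=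
  (h.isGreatest_flatEpiSubexts hinj).isLUB.sSup_eq

end AlmostPrufer

/-! ### Localization at a prime -/

section Localization

theorem isUnit_algebraMap_of_mem_primeCompl {R S : Type*} [CommRing R] [CommRing S] [Algebra R S]
    (P : Ideal R) [P.IsPrime] (S_P : Type*) [CommRing S_P] [Algebra S S_P]
    [IsLocalization (Algebra.algebraMapSubmonoid S P.primeCompl) S_P]
    [Algebra R S_P] [IsScalarTower R S S_P] {s : R} (hs : s ∈ P.primeCompl) :
    IsUnit (algebraMap R S_P s) := by
  rw [IsScalarTower.algebraMap_apply R S S_P]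
  exact IsLocalization.map_units S_P
    (⟨_, s, hs, rfl⟩ : Algebra.algebraMapSubmonoid S P.primeCompl)

theorem injective_algebraMap_localization {R S : Type*} [CommRing R] [CommRing S] [Algebra R S]
    (P : Ideal R) [P.IsPrime] (R_P S_P : Type*) [CommRing R_P] [CommRing S_P]
    [Algebra R R_P] [IsLocalization.AtPrime R_P P]
    [Algebra S S_P] [IsLocalization (Algebra.algebraMapSubmonoid S P.primeCompl) S_P]
    [Algebra R S_P] [IsScalarTower R S S_P] [Algebra R_P S_P] [IsScalarTower R R_P S_P]
    (hinj : Function.Injective (algebraMap R S)) :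
    Function.Injective (algebraMap R_P S_P) := by
  rw [injective_iff_map_eq_zero]
  intro x hx
  obtain ⟨⟨r, s⟩, h⟩ := IsLocalization.surj P.primeCompl x
  have h0 : algebraMap S S_P (algebraMap R S r) = 0 := by
    rw [← IsScalarTower.algebraMap_apply, IsScalarTower.algebraMap_apply R R_P S_P, ← h, map_mul,
      hx, zero_mul]
  obtain ⟨⟨_, t, ht, rfl⟩, h1⟩ := (IsLocalization.map_eq_zero_iff
    (Algebra.algebraMapSubmonoid S P.primeCompl) S_P _).mp h0
  have h2 : t * r = 0 := hinj (by simpa using h1)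
  refine (IsLocalization.map_units R_P s).mul_left_eq_zero.mp ?_
  exact h.trans ((IsLocalization.map_eq_zero_iff P.primeCompl R_P r).mpr ⟨⟨t, ht⟩, h2⟩)

variable {R S : Type*} [CommRing R] [CommRing S] [Algebra R S]
  (P : Ideal R) [P.IsPrime] (R_P S_P : Type*) [CommRing R_P] [CommRing S_P]
  [Algebra R R_P] [IsLocalization.AtPrime R_P P]
  [Algebra S S_P] [IsLocalization (Algebra.algebraMapSubmonoid S P.primeCompl) S_P]
  [Algebra R S_P] [IsScalarTower R S S_P] [Algebra R_P S_P] [IsScalarTower R R_P S_P]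

theorem IsElementwisePrufer.localizedSubalgebra {T : Subalgebra R S}
    (h : IsElementwisePrufer R T) :
    IsElementwisePrufer R_P (localizedSubalgebra P R_P S_P T) := by
  rintro ⟨x, t, ht, s, hs, hx⟩
  obtain ⟨b, c, d, hc, hd⟩ := h ⟨t, ht⟩
  have hc' : algebraMap R S c = algebraMap R S b * t := congrArg Subtype.val hc
  have hd' : algebraMap R S d = (1 - algebraMap R S c) * t := congrArg Subtype.val hd
  have hc'' := congrArg (algebraMap S S_P) hc'
  have hd'' := congrArg (algebraMap S S_P) hd'
  simp only [map_mul, map_sub, map_one, ← IsScalarTower.algebraMap_apply R S S_P, ← hx]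
    at hc'' hd''
  -- If `b, c, d` serve `t`, then `b * s, c, d / s` serve `x = t / s`.
  refine ⟨algebraMap R R_P (b * s), algebraMap R R_P c,
    IsLocalization.mk' R_P d (⟨s, hs⟩ : P.primeCompl), Subtype.ext ?_, Subtype.ext ?_⟩
  · change algebraMap R_P S_P _ = algebraMap R_P S_P _ * x
    rw [← IsScalarTower.algebraMap_apply, ← IsScalarTower.algebraMap_apply, hc'', map_mul]
    ring
  · change algebraMap R_P S_P _ = (1 - algebraMap R_P S_P _) * x
    have hs' := isUnit_algebraMap_of_mem_primeCompl (S := S) P S_P hs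
    refine hs'.mul_left_cancel ?_
    rw [← IsScalarTower.algebraMap_apply, IsScalarTower.algebraMap_apply R R_P S_P s, ← map_mul,
      IsLocalization.mk'_spec' R_P d (⟨s, hs⟩ : P.primeCompl), ← IsScalarTower.algebraMap_apply,
      ← IsScalarTower.algebraMap_apply, hd'']
    ring

/-- A fraction `u / s` is the image of `u`, integral by its equation over `T`, times `1 / s`, which
comes from `R_P`. -/
theorem isIntegral_localizedSubalgebra (T : Subalgebra R S) [Algebra.IsIntegral T S] :
    Algebra.IsIntegral (localizedSubalgebra P R_P S_P T) S_P := by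
  set T' := localizedSubalgebra P R_P S_P T
  refine ⟨fun y => ?_⟩
  obtain ⟨⟨u, ⟨_, s, hs, rfl⟩⟩, h⟩ :=
    IsLocalization.surj (Algebra.algebraMapSubmonoid S P.primeCompl) y
  let φ : T →+* T' := ((algebraMap S S_P).comp T.val.toRingHom).codRestrict T' fun t =>
    ⟨t, t.2, 1, one_mem _, by simp⟩
  have hu : IsIntegral T' (algebraMap S S_P u) :=
    (Algebra.IsIntegral.isIntegral (R := T) u).map_of_comp_eq φ (algebraMap S S_P) rfl
  have hinv : IsIntegral T'
      (algebraMap R_P S_P (IsLocalization.mk' R_P 1 (⟨s, hs⟩ : P.primeCompl))) :=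
    isIntegral_algebraMap (R := T') (x := algebraMap R_P T' _)
  have hy : y = algebraMap S S_P u *
      algebraMap R_P S_P (IsLocalization.mk' R_P 1 (⟨s, hs⟩ : P.primeCompl)) := by
    rw [← h]
    change y = y * algebraMap S S_P (algebraMap R S s) * _
    rw [← IsScalarTower.algebraMap_apply, IsScalarTower.algebraMap_apply R R_P S_P, mul_assoc,
      ← map_mul, IsLocalization.mk'_spec' R_P 1 (⟨s, hs⟩ : P.primeCompl), map_one, map_one, mul_one]
  rw [hy]
  exact hu.mul hinv

end Localization

theorem theorem4p3 (R S : Type*) [CommRing R] [CommRing S] [Algebra R S]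
    (hinj : Function.Injective (algebraMap R S)) (hRS : IsAlmostPruferExt R S) :
    IsQuasiPruferExt R S ∧
    -- the two hulls are the greatest elements that their names promise, and they coincide
    IsGreatest (pruferSubexts R S) (pruferHull R S) ∧
    IsGreatest (flatEpiSubexts R S) (moritaHull R S) ∧
    pruferHull R S = moritaHull R S ∧
    -- the Prüfer hull commutes with localization at each prime ideal of `R`
    (∀ (P : Ideal R) [P.IsPrime] (R_P S_P : Type*) [CommRing R_P] [CommRing S_P]
      [Algebra R R_P] [IsLocalization.AtPrime R_P P]
      [Algebra S S_P] [IsLocalization (Algebra.algebraMapSubmonoid S P.primeCompl) S_P]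
      [Algebra R S_P] [IsScalarTower R S S_P] [Algebra R_P S_P] [IsScalarTower R R_P S_P],
      IsGreatest (pruferSubexts R_P S_P) (pruferHull R_P S_P) ∧
      localizedSubalgebra P R_P S_P (pruferHull R S) = pruferHull R_P S_P) ∧
    -- every flat epimorphic subextension is Prüfer
    (∀ T : Subalgebra R S, IsFlatEpi R T → IsPruferExt R T) := by
  have hquasi := hRS.isQuasiPruferExt hinj
  obtain ⟨T, hT, _⟩ := hRS
  have hTel := hT.isElementwisePrufer (injective_algebraMap_subalgebra hinj T)
  refine ⟨hquasi, ?_, ?_, ?_, ?_, fun U hU => ?_⟩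
  · rw [hT.pruferHull_eq hinj]
    exact hT.isGreatest_pruferSubexts hinj
  · rw [hT.moritaHull_eq hinj]
    exact hT.isGreatest_flatEpiSubexts hinj
  · rw [hT.pruferHull_eq hinj, hT.moritaHull_eq hinj]
  · intro P _ R_P S_P _ _ _ _ _ _ _ _ _ _
    have hinj' := injective_algebraMap_localization P R_P S_P hinj
    have := isIntegral_localizedSubalgebra P R_P S_P T
    -- Thus `R_P ⊆ S_P` is almost-Prüfer through `T_P`, and the hull computation applies again.
    have hT' : IsPruferExt R_P (localizedSubalgebra P R_P S_P T) :=
      (hTel.localizedSubalgebra P R_P S_P).isPruferExt (injective_algebraMap_subalgebra hinj' _)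
    rw [hT.pruferHull_eq hinj, hT'.pruferHull_eq hinj']
    exact ⟨hT'.isGreatest_pruferSubexts hinj', rfl⟩
  · exact (hTel.of_le hU.le_of_isIntegral).isPruferExt (injective_algebraMap_subalgebra hinj U)
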